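/- A finite $p$-group $G$ ($p$ prime) is called extraspecial if its center $Z(G)$ is cyclic of order $p$ and $G/Z(G)$ is a non-trivial elementary abelian $p$-group. The Conjugacy Decision Problem (CDP) asks, for two given elements $g,h\in G$, whether there is an $x\in G$ with $x^{-1}gx=h$. Groups are treated as black boxes: a program is a finite list of instructions for a machine with registers for group elements, stacks of group elements and stacks of bits, which can access group elements only by multiplying, inverting, testing for equality, producing the identity, and copying or moving them. Each instruction that handles group elements takes time $\tau\ge 1$; every other instruction (pushing or popping a bit, jumping, halting) takes time $1$. The input consists of a finite list $S$ of generators of $G$ and the elements $g$ and $h$. **Theorem.** The Conjugacy Decision Problem has a polynomial time solution in extraspecial $p$-groups. Precisely: there are a (deterministic) program $P$ and a constant $C$ such that for every prime $p$, every extraspecial $p$-group $G$, every finite list $S$ that generates $G$, all $g,h\in G$ and every integer $\tau\ge 1$, the program $P$ on input $(S,g,h)$ halts, answers correctly whether $g$ and $h$ are conjugate in $G$, and takes time at most $$C\,\tau\,\bigl(|S|+\log|G|\bigr),$$ where $|S|$ is the length of the list; and if the list $S$ is irredundant (no entry can be omitted without losing the generating property), it takes time at most $C\,\tau\,\log|G|$.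 In particular, counting each group operation as one step, the CDP is solved in time $\mathcal O(\log|G|)$ from an irredundant generating list. -/

import Mathlib

/-- A finite `p`-group is extraspecial if its center is cyclic of order `p` and the quotient by
the center is a non-trivial elementary abelian `p`-group. -/
structure IsExtraspecial (p : ℕ) (G : Type*) [Group G] : Prop where
  finite : Finite G
  isPGroup : IsPGroup p G
  isCyclic_center : IsCyclic (Subgroup.center G)
  card_center : Nat.card (Subgroup.center G) = p
  quotient_nontrivial : Nontrivial (G ⧸ Subgroup.center G)
  quotient_comm : ∀ a b : G ⧸ Subgroup.center G, a * b = b * a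
  quotient_pow : ∀ a : G ⧸ Subgroup.center G, a ^ p = 1

/-- No entry of the list can be left out without generating a smaller subgroup than `G`. -/
def IsIrredundant {G : Type*} [Group G] (S : List G) : Prop :=
  ∀ i < S.length, Subgroup.closure {x | x ∈ S.eraseIdx i} ≠ ⊤

namespace BlackBox

/-- Instructions of a black-box group machine. Apart from a program counter the machine has
registers holding one group element each, stacks of group elements and stacks of bits, all
numbered by natural numbers (a program uses only finitely many of them). Group elements can be
accessed only through multiplication, inversion, the identity element, the equality test and
by moving them around. -/
inductive Instr : Type
  /-- `reg i := 1` -/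
  | one (i : ℕ)
  /-- `reg i := reg j` -/
  | copy (i j : ℕ)
  /-- `reg i := reg j * reg k` -/
  | mul (i j k : ℕ)
  /-- `reg i := (reg j)⁻¹` -/
  | inv (i j : ℕ)
  /-- if `reg i = reg j`, jump to line `l` -/
  | jumpEq (i j l : ℕ)
  /-- push `reg i` onto the element stack `s` -/
  | push (i s : ℕ)
  /-- if the element stack `s` is empty, jump to line `l`; otherwise move its top to `reg i` -/
  | pop (i s l : ℕ)
  /-- push the bit `b` onto the bit stack `s` -/
  | pushBit (b : Bool) (s : ℕ)
  /-- if the bit stack `s` is empty, jump to line `l`; otherwise remove its top bit, and jump to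
  line `m` if that bit was `true` -/
  | popBit (s l m : ℕ)
  /-- jump to line `l` -/
  | jump (l : ℕ)
  /-- stop and return the answer `b` -/
  | halt (b : Bool)

/-- A program is a finite list of instructions, the lines being numbered from `0`. It does not
refer to any particular group. -/
abbrev Program : Type := List Instr

/-- Configurations of the machine working over the group `G`. -/
structure Config (G : Type*) where
  pc : ℕ
  reg : ℕ → G
  stack : ℕ → List G
  bits : ℕ → List Bool

open Classical in
/-- The configuration after a single execution of an instruction. -/
noncomputable def Instr.next {G : Type*} [Group G] : Instr → Config G → Config G
  | .one i, c => { c with pc := c.pc + 1, reg := Function.update c.reg i 1 }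
  | .copy i j, c => { c with pc := c.pc + 1, reg := Function.update c.reg i (c.reg j) }
  | .mul i j k, c =>
      { c with pc := c.pc + 1, reg := Function.update c.reg i (c.reg j * c.reg k) }
  | .inv i j, c => { c with pc := c.pc + 1, reg := Function.update c.reg i (c.reg j)⁻¹ }
  | .jumpEq i j l, c => { c with pc := if c.reg i = c.reg j then l else c.pc + 1 }
  | .push i s, c =>
      { c with pc := c.pc + 1, stack := Function.update c.stack s (c.reg i :: c.stack s) }
  | .pop i s l, c =>
      match c.stack s with
      | [] => { c with pc := l }
      | x :: xs =>
          { c with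
            pc := c.pc + 1
            reg := Function.update c.reg i x
            stack := Function.update c.stack s xs }
  | .pushBit b s, c =>
      { c with pc := c.pc + 1, bits := Function.update c.bits s (b :: c.bits s) }
  | .popBit s l m, c =>
      match c.bits s with
      | [] => { c with pc := l }
      | b :: bs =>
          { c with
            pc := if b then m else c.pc + 1
            bits := Function.update c.bits s bs }
  | .jump l, c => { c with pc := l }
  | .halt _, c => c

/-- Time taken by one instruction, if every instruction that handles group elements (a
multiplication, an inversion, an equality test, a copy or a move) takes time `τ`. -/
def Instr.cost (τ : ℕ) : Instr → ℕ
  | .one _ | .copy _ _ | .mul _ _ _ | .inv _ _ | .jumpEq _ _ _ | .push _ _ | .pop _ _ _ => τ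
  | .pushBit _ _ | .popBit _ _ _ | .jump _ | .halt _ => 1

/-- `HaltsIn P τ c b t`: started in the configuration `c`, the program `P` stops with the answer
`b`, and the total time of all instructions executed is `t`. A jump to a line that does not exist
is not a regular stop. -/
inductive HaltsIn {G : Type*} [Group G] (P : Program) (τ : ℕ) : Config G → Bool → ℕ → Prop
  | halt {c : Config G} {b : Bool} (hP : P[c.pc]? = some (.halt b)) : HaltsIn P τ c b 1
  | step {c : Config G} {I : Instr} {b : Bool} {t : ℕ} (hP : P[c.pc]? = some I)
      (hI : ∀ b', I ≠ .halt b') (h : HaltsIn P τ (I.next c) b t) :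
      HaltsIn P τ c b (I.cost τ + t)

/-- The initial configuration for an instance of the Conjugacy Decision Problem: the generators
are on the element stack `0`, and the two elements to be tested in the registers `0` and `1`. -/
def Config.init {G : Type*} [Group G] (S : List G) (g h : G) : Config G where
  pc := 0
  reg := fun i => if i = 0 then g else if i = 1 then h else 1
  stack := fun s => if s = 0 then S else []
  bits := fun _ => []

end BlackBox

/-!
In an extraspecial group every commutator is central, so for fixed `g` the map `x ↦ [g, x]` is a
homomorphism from `G` to the center. As the center has prime order, this homomorphism is trivial or
surjective, according to whether `g` is central; hence the conjugacy class of a non-central `g` is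
the whole coset of the center through `g`. Two distinct elements `g` and `h` are therefore conjugate
if and only if `g⁻¹ * h` is central and `g` is not (`IsExtraspecial.conj_iff`).

An element is central exactly when it commutes with every generator, so both conditions can be
tested in one pass over the list of generators, with a bounded number of instructions for each of
them. `BlackBox.conjProgram` does this, and `BlackBox.conjProgram_halts` gives its answer and its
running time `O(τ (|S| + 1))`.

The subgroups generated by the successive suffixes of an irredundant list grow strictly, so each has
at least twice the order of the one before. This gives `2 ^ |S| ≤ |G|`
(`IsIrredundant.two_pow_length_le_card`)
and with it the bound in terms of `log |G|` alone.
-/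

/-! ### Conjugacy in extraspecial groups -/

theorem IsExtraspecial.commutator_mem_center {p : ℕ} {G : Type*} [Group G]
    (hG : IsExtraspecial p G) (g x : G) : g⁻¹ * x⁻¹ * g * x ∈ Subgroup.center G := by
  have h := hG.quotient_comm (g : G ⧸ Subgroup.center G) x
  rw [← QuotientGroup.mk_mul, ← QuotientGroup.mk_mul, eq_comm, QuotientGroup.eq] at h
  simpa [mul_assoc] using h

/-- The homomorphism `x ↦ [g, x]` into the center. -/
def IsExtraspecial.commutatorHom {p : ℕ} {G : Type*} [Group G]
    (hG : IsExtraspecial p G) (g : G) : G →* Subgroup.center G :=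
  MonoidHom.mk' (fun x => ⟨g⁻¹ * x⁻¹ * g * x, hG.commutator_mem_center g x⟩) (by
    intro x y
    apply Subtype.ext
    have h := Subgroup.mem_center_iff.1 (hG.commutator_mem_center g x) (g⁻¹ * y⁻¹ * g)
    calc g⁻¹ * (x * y)⁻¹ * g * (x * y)
        = g⁻¹ * y⁻¹ * g * (g⁻¹ * x⁻¹ * g * x) * y := by group
      _ = g⁻¹ * x⁻¹ * g * x * (g⁻¹ * y⁻¹ * g * y) := by rw [h]; group)

theorem IsExtraspecial.conj_iff {p : ℕ} (hp : p.Prime) {G : Type*} [Group G]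
    (hG : IsExtraspecial p G) {g h : G} (hgh : g ≠ h) :
    (∃ x : G, x⁻¹ * g * x = h) ↔
      g⁻¹ * h ∈ Subgroup.center G ∧ g ∉ Subgroup.center G := by
  constructor
  · rintro ⟨x, rfl⟩
    refine ⟨by simpa [mul_assoc] using hG.commutator_mem_center g x, fun hg => hgh ?_⟩
    rw [mul_assoc, ← Subgroup.mem_center_iff.1 hg x, inv_mul_cancel_left]
  · rintro ⟨hz, hg⟩
    have : Fact (Nat.card (Subgroup.center G)).Prime := ⟨hG.card_center.symm ▸ hp⟩
    rcases (hG.commutatorHom g).range.eq_bot_or_eq_top_of_prime_card with hr | hr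
    · refine absurd (Subgroup.mem_center_iff.2 fun x => ?_) hg
      have h1 : hG.commutatorHom g x = 1 := by
        rw [← Subgroup.mem_bot, ← hr]
        exact ⟨x, rfl⟩
      have h2 : g⁻¹ * x⁻¹ * g * x = 1 := congrArg Subtype.val h1
      have h3 : (x * g)⁻¹ * (g * x) = 1 := by simpa [mul_assoc] using h2
      exact inv_mul_eq_one.1 h3
    · obtain ⟨x, hx⟩ := MonoidHom.range_eq_top.1 hr ⟨g⁻¹ * h, hz⟩
      have h2 : g⁻¹ * x⁻¹ * g * x = g⁻¹ * h := congrArg Subtype.val hx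
      refine ⟨x, mul_left_cancel (a := g⁻¹) ?_⟩
      simpa [mul_assoc] using h2

theorem mem_center_iff_forall_commute {G : Type*} [Group G] {S : List G}
    (hS : Subgroup.closure {x | x ∈ S} = ⊤) (z : G) :
    z ∈ Subgroup.center G ↔ ∀ s ∈ S, z * s = s * z := by
  refine ⟨fun hz s _ => (Subgroup.mem_center_iff.1 hz s).symm, fun hz => ?_⟩
  have hle : Subgroup.closure {x | x ∈ S} ≤ Subgroup.centralizer {z} :=
    (Subgroup.closure_le _).2 fun s hs => Subgroup.mem_centralizer_singleton_iff.2 (hz s hs).symm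
  rw [hS] at hle
  exact Subgroup.mem_center_iff.2 fun x =>
    Subgroup.mem_centralizer_singleton_iff.1 (hle (Subgroup.mem_top x))

/-! ### Irredundant generating lists -/

theorem Subgroup.two_mul_card_le_of_lt {G : Type*} [Group G] [Finite G] {H K : Subgroup G}
    (h : H < K) : 2 * Nat.card H ≤ Nat.card K := by
  obtain ⟨k, hk⟩ := Subgroup.card_dvd_of_le h.le
  have hK : 0 < Nat.card K := Nat.card_pos
  have hne : Nat.card H ≠ Nat.card K := fun he =>
    h.ne (Subgroup.eq_of_le_of_card_ge h.le he.ge)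
  rcases k with _ | _ | k
  · omega
  · omega
  · rw [hk, mul_comm]
    exact Nat.mul_le_mul_left _ (by omega)

/-- An entry lying in the subgroup generated by the entries after it could be omitted. Hence along
the suffixes of an irredundant list the generated subgroups grow strictly. -/
theorem IsIrredundant.two_pow_le_card_closure_suffix {G : Type*} [Group G] [Finite G] {S : List G}
    (hS : Subgroup.closure {x | x ∈ S} = ⊤) (hirr : IsIrredundant S) (T : List G) :
    ∀ R : List G, S = R ++ T → 2 ^ T.length ≤ Nat.card (Subgroup.closure {x | x ∈ T}) := by
  induction T with
  | nil => exact fun _ _ => Nat.card_pos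
  | cons s T ih =>
    intro R hR
    have hlt : Subgroup.closure {x | x ∈ T} < Subgroup.closure {x | x ∈ s :: T} := by
      refine lt_of_le_not_ge
        (Subgroup.closure_mono fun x hx => List.mem_cons_of_mem s hx) fun hge => ?_
      have he : S.eraseIdx R.length = R ++ T := by
        simp [hR, List.eraseIdx_append_of_length_le]
      refine hirr R.length (by simp [hR]) ?_
      rw [he, eq_top_iff, ← hS, Subgroup.closure_le]
      intro x hx
      have hx' : x ∈ R ∨ x ∈ s :: T := by
        rw [← List.mem_append, ← hR]
        exact hx
      rcases hx' with hx' | hx'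
      · exact Subgroup.subset_closure (List.mem_append_left T hx')
      · exact Subgroup.closure_mono (fun y hy => List.mem_append_right R hy)
          (hge (Subgroup.subset_closure hx'))
    have h1 := ih (R ++ [s]) (by simpa using hR)
    have h2 := Subgroup.two_mul_card_le_of_lt hlt
    rw [List.length_cons, pow_succ]
    omega

theorem IsIrredundant.two_pow_length_le_card {G : Type*} [Group G] [Finite G] {S : List G}
    (hS : Subgroup.closure {x | x ∈ S} = ⊤) (hirr : IsIrredundant S) :
    2 ^ S.length ≤ Nat.card G :=
  (hirr.two_pow_le_card_closure_suffix hS S [] rfl).trans (Subgroup.card_le_card_group _)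

namespace BlackBox

/-! ### The program -/

/-- The program deciding conjugacy. Lines 0 to 2 accept if the two given elements `g` and `h` are
equal, and otherwise put `z = g⁻¹ * h` into register 2. Lines 3 to 10 pop the generators and reject
once one does not commute with `z` or the stack is empty; on meeting a generator that does not
commute with `g` they pass control to lines 11 to 14, which test the remaining generators against
`z` only and accept when the stack is empty. -/
def conjProgram : Program :=
  [.jumpEq 0 1 16,
   .inv 2 0,
   .mul 2 2 1,
   .pop 3 0 15,
   .mul 4 2 3,
   .mul 5 3 2,
   .jumpEq 4 5 8,
   .halt false,
   .mul 4 0 3,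
   .mul 5 3 0,
   .jumpEq 4 5 3,
   .pop 3 0 16,
   .mul 4 2 3,
   .mul 5 3 2,
   .jumpEq 4 5 11,
   .halt false,
   .halt true]

/-- The program halts from `c` with answer `b` in total time at most `T`. -/
def HaltsWithin {G : Type*} [Group G] (P : Program) (τ : ℕ) (c : Config G) (b : Bool)
    (T : ℕ) : Prop :=
  ∃ t ≤ T, HaltsIn P τ c b t

theorem HaltsWithin.mono {G : Type*} [Group G] {P : Program} {τ : ℕ} {c : Config G} {b : Bool}
    {T T' : ℕ} (h : HaltsWithin P τ c b T) (hT : T ≤ T') : HaltsWithin P τ c b T' :=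
  let ⟨t, ht, hc⟩ := h
  ⟨t, ht.trans hT, hc⟩

theorem HaltsWithin.step {G : Type*} [Group G] {P : Program} {τ : ℕ} {c : Config G} {b : Bool}
    {T : ℕ} (I : Instr) (hP : P[c.pc]? = some I) (hI : ∀ b', I ≠ .halt b')
    (h : HaltsWithin P τ (I.next c) b T) : HaltsWithin P τ c b (I.cost τ + T) :=
  let ⟨t, ht, hc⟩ := h
  ⟨I.cost τ + t, Nat.add_le_add_left ht _, .step hP hI hc⟩

theorem HaltsWithin.halt {G : Type*} [Group G] {P : Program} {τ : ℕ} {c : Config G} {b : Bool}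
    (hP : P[c.pc]? = some (.halt b)) : HaltsWithin P τ c b 1 :=
  ⟨1, le_rfl, .halt hP⟩

/-- The second loop of the program: the remaining generators are tested against `z` only. -/
theorem conjProgram_loop_noncentral {G : Type*} [Group G] (τ : ℕ) (L : List G) :
    ∀ c : Config G, c.pc = 11 → c.stack 0 = L →
      ∃ b : Bool, HaltsWithin conjProgram τ c b (τ * (4 * L.length + 1) + 1) ∧
        (b = true ↔ ∀ s ∈ L, c.reg 2 * s = s * c.reg 2) := by
  induction L with
  | nil =>
    rintro ⟨pc, reg, stack, bits⟩ rfl hst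
    refine ⟨true, ?_, by simp⟩
    refine (HaltsWithin.step (T := 1) (.pop 3 0 16) rfl nofun ?_).mono
      (by simp [Instr.cost])
    simp only at hst
    simp only [Instr.next, hst]
    exact .halt rfl
  | cons s L ih =>
    rintro ⟨pc, reg, stack, bits⟩ rfl hst
    simp only at hst
    by_cases hs : reg 2 * s = s * reg 2
    · obtain ⟨b, hb, hb'⟩ := ih
        ⟨11, Function.update (Function.update (Function.update reg 3 s) 4 (reg 2 * s)) 5
          (s * reg 2), Function.update stack 0 L, bits⟩ rfl (by simp)
      refine ⟨b, ?_, by simpa [hs] using hb'⟩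
      refine (HaltsWithin.step (.pop 3 0 16) rfl nofun
        (T := τ + (τ + (τ + (τ * (4 * L.length + 1) + 1)))) ?_).mono
        (by simp only [Instr.cost, List.length_cons]; linarith)
      simp only [Instr.next, hst]
      refine HaltsWithin.step (.mul 4 2 3) rfl nofun ?_
      refine HaltsWithin.step (.mul 5 3 2) rfl nofun ?_
      refine HaltsWithin.step (.jumpEq 4 5 11) rfl nofun ?_
      simpa [Instr.next, hs] using hb
    · refine ⟨false, ?_, by simp [hs]⟩
      refine (HaltsWithin.step (.pop 3 0 16) rfl nofun
        (T := τ + (τ + (τ + 1))) ?_).mono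
        (by simp only [Instr.cost, List.length_cons]; nlinarith [Nat.zero_le (τ * L.length)])
      simp only [Instr.next, hst]
      refine HaltsWithin.step (.mul 4 2 3) rfl nofun ?_
      refine HaltsWithin.step (.mul 5 3 2) rfl nofun ?_
      refine HaltsWithin.step (.jumpEq 4 5 11) rfl nofun ?_
      refine HaltsWithin.halt ?_
      simp [Instr.next, hs, conjProgram]

/-- The first loop of the program: no generator met so far fails to commute with `g`. -/
theorem conjProgram_loop {G : Type*} [Group G] (τ : ℕ) (L : List G) :
    ∀ c : Config G, c.pc = 3 → c.stack 0 = L →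
      ∃ b : Bool, HaltsWithin conjProgram τ c b (τ * (7 * L.length + 1) + 1) ∧
        (b = true ↔ (∀ s ∈ L, c.reg 2 * s = s * c.reg 2) ∧
          ¬ ∀ s ∈ L, c.reg 0 * s = s * c.reg 0) := by
  classical
  induction L with
  | nil =>
    rintro ⟨pc, reg, stack, bits⟩ rfl hst
    refine ⟨false, ?_, by simp⟩
    refine (HaltsWithin.step (T := 1) (.pop 3 0 15) rfl nofun ?_).mono
      (by simp [Instr.cost])
    simp only at hst
    simp only [Instr.next, hst]
    exact .halt rfl
  | cons s L ih =>
    rintro ⟨pc, reg, stack, bits⟩ rfl hst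
    simp only at hst
    by_cases hs : reg 2 * s = s * reg 2
    · let r := Function.update (Function.update (Function.update reg 3 s) 4 (reg 0 * s)) 5
        (s * reg 0)
      -- Both continuations below run lines 3 to 6 and 8 to 10, at a cost of `7 * τ`.
      have key : ∀ b,
          HaltsWithin conjProgram τ ⟨if reg 0 * s = s * reg 0 then 3 else 11,
            r, Function.update stack 0 L, bits⟩ b (τ * (7 * L.length + 1) + 1) →
          HaltsWithin conjProgram τ ⟨3, reg, stack, bits⟩ b
            (τ * (7 * (s :: L).length + 1) + 1) := by
        intro b hb
        refine (HaltsWithin.step (.pop 3 0 15) rfl nofun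
          (T := τ + (τ + (τ + (τ + (τ + (τ + (τ * (7 * L.length + 1) + 1))))))) ?_).mono
          (by simp only [Instr.cost, List.length_cons]; linarith)
        simp only [Instr.next, hst]
        refine HaltsWithin.step (.mul 4 2 3) rfl nofun ?_
        refine HaltsWithin.step (.mul 5 3 2) rfl nofun ?_
        refine HaltsWithin.step (.jumpEq 4 5 8) rfl nofun ?_
        refine HaltsWithin.step (.mul 4 0 3) (by simp [Instr.next, hs, conjProgram]) nofun ?_
        refine HaltsWithin.step (.mul 5 3 0) (by simp [Instr.next, hs, conjProgram]) nofun ?_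
        refine HaltsWithin.step (.jumpEq 4 5 3) (by simp [Instr.next, hs, conjProgram]) nofun ?_
        convert hb using 1
        simp only [Instr.next, Config.mk.injEq, and_true]
        refine ⟨by simp [hs], ?_⟩
        funext i
        by_cases h5 : i = 5 <;> by_cases h4 : i = 4 <;> simp [r, Function.update_apply, h4, h5]
      by_cases hg : reg 0 * s = s * reg 0
      · rw [if_pos hg] at key
        obtain ⟨b, hb, hb'⟩ := ih ⟨3, r, Function.update stack 0 L, bits⟩ rfl
          (Function.update_self 0 L stack)
        exact ⟨b, key b hb, by simpa [r, hs, hg] using hb'⟩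
      · rw [if_neg hg] at key
        obtain ⟨b, hb, hb'⟩ := conjProgram_loop_noncentral τ L
          ⟨11, r, Function.update stack 0 L, bits⟩ rfl (Function.update_self 0 L stack)
        refine ⟨b, key b (hb.mono ?_), by simpa [r, hs, hg] using hb'⟩
        gcongr
        norm_num
    · refine ⟨false, ?_, by simp [hs]⟩
      refine (HaltsWithin.step (.pop 3 0 15) rfl nofun
        (T := τ + (τ + (τ + 1))) ?_).mono
        (by simp only [Instr.cost, List.length_cons]; nlinarith [Nat.zero_le (τ * L.length)])
      simp only [Instr.next, hst]
      refine HaltsWithin.step (.mul 4 2 3) rfl nofun ?_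
      refine HaltsWithin.step (.mul 5 3 2) rfl nofun ?_
      refine HaltsWithin.step (.jumpEq 4 5 8) rfl nofun ?_
      refine HaltsWithin.halt ?_
      simp [Instr.next, hs, conjProgram]

theorem conjProgram_halts {G : Type*} [Group G] (τ : ℕ) (S : List G) (g h : G) :
    ∃ b : Bool, HaltsWithin conjProgram τ (Config.init S g h) b (τ * (7 * S.length + 4) + 1) ∧
      (b = true ↔ g = h ∨ ((∀ s ∈ S, (g⁻¹ * h) * s = s * (g⁻¹ * h)) ∧
        ¬ ∀ s ∈ S, g * s = s * g)) := by
  by_cases hgh : g = h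
  · refine ⟨true, ?_, by simp [hgh]⟩
    refine (HaltsWithin.step (T := 1) (.jumpEq 0 1 16) rfl nofun ?_).mono
      (by simp only [Instr.cost]; nlinarith [Nat.zero_le (τ * S.length)])
    refine HaltsWithin.halt ?_
    simp [Instr.next, Config.init, hgh, conjProgram]
  · let r : ℕ → G := fun i => if i = 0 then g else if i = 1 then h else 1
    obtain ⟨b, hb, hb'⟩ := conjProgram_loop τ S
      ⟨3, Function.update r 2 (g⁻¹ * h), fun s => if s = 0 then S else [], fun _ => []⟩
      rfl rfl
    refine ⟨b, ?_, by simpa [hgh, r] using hb'⟩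
    refine (HaltsWithin.step (.jumpEq 0 1 16) rfl nofun
      (T := τ + (τ + (τ * (7 * S.length + 1) + 1))) ?_).mono
      (by simp only [Instr.cost]; linarith)
    refine HaltsWithin.step (.inv 2 0) (by simp [Instr.next, Config.init, hgh, conjProgram])
      nofun ?_
    refine HaltsWithin.step (.mul 2 2 1) (by simp [Instr.next, Config.init, hgh, conjProgram])
      nofun ?_
    simpa [Instr.next, Config.init, hgh, r] using hb

end BlackBox

/-! ### The running time -/

theorem mainTheorem6 :
    ∃ (P : BlackBox.Program) (C : ℕ),
      ∀ (p : ℕ) (_ : p.Prime) (G : Type*) [Group G] (_ : IsExtraspecial p G)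
        (S : List G) (_ : Subgroup.closure {x | x ∈ S} = ⊤) (g h : G) (τ : ℕ) (_ : 1 ≤ τ),
        ∃ (b : Bool) (t : ℕ),
          BlackBox.HaltsIn P τ (BlackBox.Config.init S g h) b t ∧
          (b = true ↔ ∃ x : G, x⁻¹ * g * x = h) ∧
          (t : ℝ) ≤ C * τ * (S.length + Real.log (Nat.card G)) ∧
          (IsIrredundant S → (t : ℝ) ≤ C * τ * Real.log (Nat.card G)) := by
  -- The time is at most `τ * (7 * |S| + 5)`, and `1` and, for irredundant `S`, also `|S|` are at
  -- most `log |G| / log 2 < 1.5 * log |G|`; this makes `12 * 1.5 = 18` sufficient.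
  refine ⟨BlackBox.conjProgram, 18, ?_⟩
  intro p hp G _ hG S hS g h τ hτ
  have := hG.finite
  obtain ⟨b, ⟨t, ht, hc⟩, hb⟩ := BlackBox.conjProgram_halts τ S g h
  have htR : (t : ℝ) ≤ τ * (7 * S.length + 5) := by
    have h1 : t ≤ τ * (7 * S.length + 5) := by linarith
    exact_mod_cast h1
  have hlog2 : (2 / 3 : ℝ) ≤ Real.log 2 := by linarith [Real.log_two_gt_d9]
  have hlog : Real.log 2 ≤ Real.log (Nat.card G) := by
    refine Real.log_le_log (by norm_num) ?_
    have h1 : p ≤ Nat.card G := hG.card_center ▸ Subgroup.card_le_card_group (Subgroup.center G)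
    exact_mod_cast hp.two_le.trans h1
  have hS0 : (0 : ℝ) ≤ S.length := Nat.cast_nonneg _
  refine ⟨b, t, hc, ?_, htR.trans ?_, fun hirr => htR.trans ?_⟩
  · rw [hb, ← mem_center_iff_forall_commute hS, ← mem_center_iff_forall_commute hS]
    by_cases hgh : g = h
    · exact ⟨fun _ => ⟨1, by simp [hgh]⟩, fun _ => Or.inl hgh⟩
    · rw [hG.conj_iff hp hgh, or_iff_right hgh]
  · rw [mul_comm ((18 : ℕ) : ℝ), mul_assoc]
    refine mul_le_mul_of_nonneg_left ?_ (Nat.cast_nonneg τ)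
    push_cast
    linarith
  · have hlen : S.length * Real.log 2 ≤ Real.log (Nat.card G) := by
      rw [← Real.log_pow]
      refine Real.log_le_log (by positivity) ?_
      exact_mod_cast hirr.two_pow_length_le_card hS
    have hlen' : (S.length : ℝ) * (2 / 3) ≤ S.length * Real.log 2 :=
      mul_le_mul_of_nonneg_left hlog2 hS0
    rw [mul_comm ((18 : ℕ) : ℝ), mul_assoc]
    refine mul_le_mul_of_nonneg_left ?_ (Nat.cast_nonneg τ)
    push_cast
    linarith
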